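/- The category $\mathsf{KAlgFrm_S}$ is equivalent to $\mathsf{BDMS_S}$ and dually equivalent to $\mathsf{GPS_S}$; consequently $\mathsf{BDMS_S}$ is dually equivalent to $\mathsf{GPS_S}$ (the Bezhanishvili–Jansana duality). The three categories are the following. (1) Objects of $\mathsf{KAlgFrm_S}$ are compact algebraic frames: complete lattices $L$ satisfying $a\wedge\bigvee S=\bigvee\{a\wedge s\mid s\in S\}$ for all $a\in L$, $S\subseteq L$, in which every element is a join of compact elements and the top element is compact. Write $K(L)$ for the set of compact elements of $L$. Morphisms $\alpha:L_1\to L_2$ are the maps that preserve arbitrary joins, send compact elements to compact elements, and satisfy $\alpha(\bigwedge S)=\bigwedge\alpha[S]$ for every finite (possibly empty) $S\subseteq K(L_1)$ with $\bigwedge S\in K(L_1)$. (2) Objects of $\mathsf{BDMS_S}$ are bounded distributive meet-semilattices: meet-semilattices $M$ with top and bottom such that whenever $a\wedge b\le c$ in $M$, there are $a'\ge a$ and $b'\ge b$ in $M$ with $a'\wedge b'=c$. Morphisms are sup-homomorphisms: maps preserving all finite meets (including the top) and all existing finite joins (including the bottom). (3) Objects of $\mathsf{GPS_S}$ are generalized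 Priestley spaces: tuples $\langle X,\tau,\le,X_0\rangle$, with $X_0\subseteq X$, such that - $\langle X,\tau,\le\rangle$ is a Priestley space, i.e. $\langle X,\tau\rangle$ is compact, $\le$ is a partial order, and whenever $x\not\le y$ there is a clopen upset containing $x$ and missing $y$; - $X_0$ is topologically dense in $X$, and each $x\in X$ lies below some $y\in X_0$; - $x\in X_0$ if and only if $\{U\in\mathcal A(X)\mid x\notin U\}$ is directed under inclusion; - $x\le y$ if and only if every $U\in\mathcal A(X)$ containing $x$ contains $y$. Here $\mathcal A(X)$ is the set of admissible clopen upsets of $X$, a clopen upset $U$ being admissible if every maximal element of $X\setminus U$ belongs to $X_0$. Morphisms are strong Priestley morphisms: order-preserving maps $f:X\to Y$ such that $f^{-1}(U)\in\mathcal A(X)$ for each $U\in\mathcal A(Y)$. Composition is composition of functions. -/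

import Mathlib

open CategoryTheory

universe u

/-! ## Compact algebraic frames -/

/-- A compact algebraic frame: a frame in which every element is a join of compact elements and
whose top element is compact. -/
structure KAlgFrmS : Type (u + 1) where
  carrier : Type u
  [frame : Order.Frame carrier]
  [algebraic : IsCompactlyGenerated carrier]
  isCompactElement_top : IsCompactElement (⊤ : carrier)

namespace KAlgFrmS

instance : CoeSort KAlgFrmS.{u} (Type u) := ⟨carrier⟩

attribute [instance] frame algebraic

/-- Maps preserving arbitrary joins, compact elements, and those finite meets of compact elements
that are compact (including the empty meet). -/
@[ext]
structure Hom (L M : KAlgFrmS.{u}) : Type u where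
  toFun : L → M
  map_sSup : ∀ S : Set L, toFun (sSup S) = sSup (toFun '' S)
  map_compact : ∀ k : L, IsCompactElement k → IsCompactElement (toFun k)
  map_sInf : ∀ S : Set L, S.Finite → (∀ k ∈ S, IsCompactElement k) →
    IsCompactElement (sInf S) → toFun (sInf S) = sInf (toFun '' S)

/-- The category of compact algebraic frames. -/
instance : Category.{u} KAlgFrmS.{u} where
  Hom := Hom
  id L :=
    { toFun := id
      map_sSup := fun S => by simp
      map_compact := fun _ hk => hk
      map_sInf := fun S _ _ _ => by simp }
  comp f g :=
    { toFun := g.toFun ∘ f.toFun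
      map_sSup := fun S => by
        rw [Set.image_comp, Function.comp_apply, f.map_sSup, g.map_sSup]
      map_compact := fun k hk => g.map_compact _ (f.map_compact k hk)
      map_sInf := fun S hS hk hI => by
        rw [Set.image_comp, Function.comp_apply, f.map_sInf S hS hk hI]
        refine g.map_sInf _ (hS.image _) ?_ ?_
        · rintro _ ⟨k, hkS, rfl⟩
          exact f.map_compact k (hk k hkS)
        · rw [← f.map_sInf S hS hk hI]
          exact f.map_compact _ hI }

end KAlgFrmS

/-! ## Bounded distributive meet-semilattices -/

/-- A bounded distributive meet-semilattice. -/
structure BDMSS : Type (u + 1) where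
  carrier : Type u
  [semilatticeInf : SemilatticeInf carrier]
  [boundedOrder : BoundedOrder carrier]
  distrib : ∀ a b c : carrier, a ⊓ b ≤ c → ∃ a' b' : carrier, a ≤ a' ∧ b ≤ b' ∧ a' ⊓ b' = c

namespace BDMSS

instance : CoeSort BDMSS.{u} (Type u) := ⟨carrier⟩

attribute [instance] semilatticeInf boundedOrder

/-- Sup-homomorphisms: maps preserving all finite meets and all existing finite joins
(including the empty meet `⊤` and the empty join `⊥`). -/
@[ext]
structure Hom (M N : BDMSS.{u}) : Type u where
  toFun : M → N
  map_top : toFun ⊤ = ⊤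
  map_inf : ∀ a b : M, toFun (a ⊓ b) = toFun a ⊓ toFun b
  map_isLUB : ∀ (S : Set M) (a : M), S.Finite → IsLUB S a → IsLUB (toFun '' S) (toFun a)

/-- The category of bounded distributive meet-semilattices and sup-homomorphisms. -/
instance : Category.{u} BDMSS.{u} where
  Hom := Hom
  id M :=
    { toFun := id
      map_top := rfl
      map_inf := fun _ _ => rfl
      map_isLUB := fun S a _ h => by simpa using h }
  comp f g :=
    { toFun := g.toFun ∘ f.toFun
      map_top := by rw [Function.comp_apply, f.map_top, g.map_top]
      map_inf := fun a b => by simp only [Function.comp_apply, f.map_inf, g.map_inf]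
      map_isLUB := fun S a hS h => by
        rw [Set.image_comp]
        exact g.map_isLUB _ _ (hS.image _) (f.map_isLUB S a hS h) }

end BDMSS

/-! ## Generalized Priestley spaces -/

section Admissible

variable {X : Type u} [TopologicalSpace X] [PartialOrder X]

/-- A clopen upset `U` is admissible, relative to a subset `X₀`, if every maximal element of its
complement lies in `X₀`. -/
def IsAdmissible (X₀ U : Set X) : Prop :=
  IsClopen U ∧ IsUpperSet U ∧ ∀ x, Maximal (fun y => y ∈ Uᶜ) x → x ∈ X₀

/-- The family of admissible clopen upsets not containing `x`. -/
def admissibleMissing (X₀ : Set X) (x : X) : Set (Set X) :=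
  {U | IsAdmissible X₀ U ∧ x ∉ U}

end Admissible

/-- A generalized Priestley space `⟨X, τ, ≤, X₀⟩`. -/
structure GPSS : Type (u + 1) where
  carrier : Type u
  [topologicalSpace : TopologicalSpace carrier]
  [partialOrder : PartialOrder carrier]
  [compactSpace : CompactSpace carrier]
  [priestleySpace : PriestleySpace carrier]
  X₀ : Set carrier
  dense : Dense X₀
  order_dense : ∀ x : carrier, ∃ y ∈ X₀, x ≤ y
  mem_iff_directed : ∀ x : carrier, x ∈ X₀ ↔ DirectedOn (· ⊆ ·) (admissibleMissing X₀ x)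
  le_iff : ∀ x y : carrier, x ≤ y ↔ ∀ U : Set carrier, IsAdmissible X₀ U → x ∈ U → y ∈ U

namespace GPSS

instance : CoeSort GPSS.{u} (Type u) := ⟨carrier⟩

attribute [instance] topologicalSpace partialOrder compactSpace priestleySpace

/-- Strong Priestley morphisms: order-preserving maps under which preimages of admissible clopen
upsets are admissible clopen upsets. -/
@[ext]
structure Hom (X Y : GPSS.{u}) : Type u where
  toFun : X → Y
  monotone : Monotone toFun
  preimage_admissible : ∀ U : Set Y, IsAdmissible Y.X₀ U → IsAdmissible X.X₀ (toFun ⁻¹' U)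

/-- The category of generalized Priestley spaces and strong Priestley morphisms. -/
instance : Category.{u} GPSS.{u} where
  Hom := Hom
  id X :=
    { toFun := id
      monotone := monotone_id
      preimage_admissible := fun _ hU => hU }
  comp f g :=
    { toFun := g.toFun ∘ f.toFun
      monotone := g.monotone.comp f.monotone
      preimage_admissible := fun U hU =>
        f.preimage_admissible _ (g.preimage_admissible U hU) }

end GPSS

/-!
A compact algebraic frame is recovered from its join-semilattice of compact elements as the lattice
of ideals, and the frame law turns into distributivity of that semilattice. Maps out of the compact
elements extend along directed joins, and preservation of finite meets is read off on compact
elements.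

For the duality, the points of the dual space of `M` are the filters whose complement is a Frink
ideal, with the prime filters as `X₀`. In the frame of filters of `M`, a principal filter not
contained in a given filter can be kept out of some meet-prime filter above it; hence prime filters
separate elements and are dense. Compactness then shows that the admissible clopen upsets are
exactly the sets `{x | a ∈ x}`, which gives back `M`. Conversely, in a generalized Priestley space,
density of `X₀` makes the admissible sets containing a point an optimal filter, and the image of
the resulting map is both compact and dense, so every optimal filter arises in this way.
-/

theorem exists_mem_forall_rel_of_finite {α : Type*} {r : α → α → Prop} [IsTrans α r]
    {s t : Set α} (hs : DirectedOn r s) (hne : s.Nonempty) (ht : t.Finite) (hts : t ⊆ s) :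
    ∃ u ∈ s, ∀ a ∈ t, r a u := by
  have := hne.to_subtype
  obtain ⟨u, hu⟩ :=
    hs.directed_val.finite_set_le (ht.preimage (Subtype.val_injective (p := (· ∈ s))).injOn)
  exact ⟨u, u.2, fun a ha => hu ⟨a, hts ha⟩ ha⟩

/-! ## Distributive semilattices -/

/-- A meet-semilattice is distributive if every inequality `a ⊓ b ≤ c` comes from a factorization
of `c` into an element above `a` and an element above `b`. -/
class IsDistribInf (M : Type*) [SemilatticeInf M] : Prop where
  exists_inf_eq {a b c : M} (h : a ⊓ b ≤ c) : ∃ a' b', a ≤ a' ∧ b ≤ b' ∧ a' ⊓ b' = c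

/-- A join-semilattice is distributive if every element below `a ⊔ b` is the join of an element
below `a` and an element below `b`. -/
class IsDistribSup (P : Type*) [SemilatticeSup P] : Prop where
  exists_sup_eq {a b c : P} (h : c ≤ a ⊔ b) : ∃ a' b', a' ≤ a ∧ b' ≤ b ∧ a' ⊔ b' = c

instance (M : Type*) [SemilatticeInf M] [IsDistribInf M] : IsDistribSup Mᵒᵈ where
  exists_sup_eq h := IsDistribInf.exists_inf_eq (M := M) h

instance (P : Type*) [SemilatticeSup P] [IsDistribSup P] : IsDistribInf Pᵒᵈ where
  exists_inf_eq h := IsDistribSup.exists_sup_eq (P := P) h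

instance (M : BDMSS.{u}) : IsDistribInf M where
  exists_inf_eq := M.distrib _ _ _

/-! ## Compact elements of a complete lattice -/

section CompactElements

variable {α β : Type*} [CompleteLattice α]

theorem isCompactElement_bot : IsCompactElement (⊥ : α) := by
  simpa using CompleteLattice.isCompactElement_finsetSup (∅ : Finset α) (f := id) (by simp)

theorem isCompactElement_sup {a b : α} (ha : IsCompactElement a) (hb : IsCompactElement b) :
    IsCompactElement (a ⊔ b) := by
  classical
  simpa using
    CompleteLattice.isCompactElement_finsetSup ({a, b} : Finset α) (f := id) (by simp [ha, hb])

theorem exists_infIrred_of_isCompactElement_of_not_le {k a : α} (hk : IsCompactElement k)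
    (hka : ¬k ≤ a) : ∃ m, a ≤ m ∧ ¬k ≤ m ∧ InfIrred m := by
  have compact := (CompleteLattice.isCompactElement_iff_le_of_directed_sSup_le α k).1 hk
  obtain ⟨m, ham, hkm, hmax⟩ := zorn_le_nonempty₀ {x | ¬k ≤ x}
    (fun c hc hchain y hy => ⟨sSup c, fun hkc => by
      obtain ⟨x, hx, hkx⟩ := compact c ⟨y, hy⟩ hchain.directedOn hkc
      exact hc hx hkx, fun _ => le_sSup⟩) a hka
  refine ⟨m, ham, hkm, fun hm => hkm (le_top.trans (hm le_top)), fun x y hxy => ?_⟩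
  by_contra! h
  have above : ∀ z, m ≤ z → z ≠ m → k ≤ z := fun z hmz hz =>
    not_not.1 fun hkz => hz (le_antisymm (hmax hkz hmz) hmz)
  exact hkm (hxy ▸ le_inf (above x (hxy ▸ inf_le_left) h.1) (above y (hxy ▸ inf_le_right) h.2))

theorem exists_infPrime_of_isCompactElement_of_not_le {α : Type*} [Order.Frame α] {k a : α}
    (hk : IsCompactElement k) (hka : ¬k ≤ a) : ∃ m, a ≤ m ∧ ¬k ≤ m ∧ InfPrime m := by
  simpa only [infPrime_iff_infIrred] using exists_infIrred_of_isCompactElement_of_not_le hk hka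

variable (α) in
/-- The compact elements of a complete lattice. -/
abbrev CompactElt : Type _ := {k : α // IsCompactElement k}

namespace CompactElt

instance : SemilatticeSup (CompactElt α) :=
  Subtype.semilatticeSup fun {_ _} => isCompactElement_sup

instance : OrderBot (CompactElt α) :=
  Subtype.orderBot isCompactElement_bot

theorem exists_le_of_le_sSup_image {D : Set (CompactElt α)} (hne : D.Nonempty)
    (hD : DirectedOn (· ≤ ·) D) {k : CompactElt α} (hk : (k : α) ≤ sSup (Subtype.val '' D)) :
    ∃ d ∈ D, k ≤ d := by
  obtain ⟨_, ⟨d, hd, rfl⟩, hkd⟩ :=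
    (CompleteLattice.isCompactElement_iff_le_of_directed_sSup_le α (k : α)).1 k.2 _
      (hne.image _) (directedOn_image.2 hD) hk
  exact ⟨d, hd, hkd⟩

section Algebraic

variable [IsCompactlyGenerated α]

theorem sSup_image_setOf_le (x : α) :
    sSup (Subtype.val '' {k : CompactElt α | (k : α) ≤ x}) = x := by
  refine le_antisymm (sSup_le ?_) (le_iff_compact_le_imp.2 fun k hk hkx => ?_)
  · rintro _ ⟨k, hkx, rfl⟩
    exact hkx
  · exact le_sSup ⟨⟨k, hk⟩, hkx, rfl⟩

theorem isGLB_iff {S : Set (CompactElt α)} {k : CompactElt α} :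
    IsGLB S k ↔ (k : α) = sInf (Subtype.val '' S) := by
  constructor
  · intro h
    refine le_antisymm (le_sInf ?_) (le_iff_compact_le_imp.2 fun l hl hlS => ?_)
    · rintro _ ⟨s, hs, rfl⟩
      exact h.1 hs
    · exact h.2 (show (⟨l, hl⟩ : CompactElt α) ∈ lowerBounds S from
        fun s hs => hlS.trans (sInf_le ⟨s, hs, rfl⟩))
  · intro h
    exact .of_image (f := Subtype.val) Subtype.coe_le_coe (h ▸ isGLB_sInf _)

theorem exists_le_sup_of_le_sup {c : CompactElt α} {x y : α} (h : (c : α) ≤ x ⊔ y) :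
    ∃ a b : CompactElt α, (a : α) ≤ x ∧ (b : α) ≤ y ∧ c ≤ a ⊔ b := by
  obtain ⟨_, ⟨a, b, ha, hb, rfl⟩, hc⟩ := exists_le_of_le_sSup_image
    (D := {d | ∃ a b : CompactElt α, (a : α) ≤ x ∧ (b : α) ≤ y ∧ a ⊔ b = d})
    ⟨_, ⊥, ⊥, bot_le, bot_le, rfl⟩
    (by
      rintro _ ⟨a, b, ha, hb, rfl⟩ _ ⟨a', b', ha', hb', rfl⟩
      exact ⟨_, ⟨a ⊔ a', b ⊔ b', sup_le ha ha', sup_le hb hb', rfl⟩,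
        sup_le_sup le_sup_left le_sup_left, sup_le_sup le_sup_right le_sup_right⟩)
    (h.trans <| by
      nth_rw 1 [← sSup_image_setOf_le x, ← sSup_image_setOf_le y]
      refine sup_le (sSup_le ?_) (sSup_le ?_)
      · rintro _ ⟨a, ha, rfl⟩
        exact le_sSup ⟨a, ⟨a, ⊥, ha, bot_le, sup_bot_eq a⟩, rfl⟩
      · rintro _ ⟨b, hb, rfl⟩
        exact le_sSup ⟨b, ⟨⊥, b, bot_le, hb, bot_sup_eq b⟩, rfl⟩)
  exact ⟨a, b, ha, hb, hc⟩

variable [CompleteLattice β]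

theorem gc_sSup_image (h : SupBotHom (CompactElt α) β) :
    GaloisConnection (fun x : α => sSup (h '' {k | (k : α) ≤ x}))
      (fun y : β => sSup (Subtype.val '' {k : CompactElt α | h k ≤ y})) := by
  intro x y
  constructor
  · intro hxy
    refine le_iff_compact_le_imp.2 fun k hk hkx => le_sSup ⟨⟨k, hk⟩, ?_, rfl⟩
    exact (le_sSup (Set.mem_image_of_mem h hkx)).trans hxy
  · intro hxy
    refine sSup_le ?_
    rintro _ ⟨k, hkx, rfl⟩
    obtain ⟨l, hly, hkl⟩ := exists_le_of_le_sSup_image (D := {k | h k ≤ y})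
      ⟨⊥, show h ⊥ ≤ y from (map_bot h).trans_le bot_le⟩
      (fun a ha b hb => ⟨a ⊔ b, (map_sup h a b).trans_le (sup_le ha hb), le_sup_left, le_sup_right⟩)
      (hkx.trans hxy)
    exact (OrderHomClass.mono h hkl).trans hly

/-- The extension of a finite-join-preserving map on compact elements to a map preserving all
joins. -/
def lift (h : SupBotHom (CompactElt α) β) : sSupHom α β where
  toFun x := sSup (h '' {k | (k : α) ≤ x})
  map_sSup' _ := (gc_sSup_image h).l_sSup.trans sSup_image.symm

@[simp]
theorem lift_coe (h : SupBotHom (CompactElt α) β) (k : CompactElt α) : lift h k = h k := by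
  refine le_antisymm (sSup_le ?_) (le_sSup ⟨k, le_rfl, rfl⟩)
  rintro _ ⟨l, hlk, rfl⟩
  exact OrderHomClass.mono h hlk

end Algebraic

instance {α : Type*} [Order.Frame α] [IsCompactlyGenerated α] : IsDistribSup (CompactElt α) where
  exists_sup_eq {a b c} h := by
    have hc : (c : α) ≤ (a : α) ⊓ c ⊔ (b : α) ⊓ c := by
      rw [← inf_sup_right]
      exact le_inf h le_rfl
    obtain ⟨a', b', ha', hb', h'⟩ := exists_le_sup_of_le_sup hc
    rw [le_inf_iff] at ha' hb'
    exact ⟨a', b', ha'.1, hb'.1, le_antisymm (sup_le ha'.2 hb'.2) h'⟩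

end CompactElt

end CompactElements

/-! ## The functor of compact elements -/

namespace BDMSS

variable {M N : BDMSS.{u}}

theorem Hom.monotone (h : Hom M N) : Monotone h.toFun :=
  Monotone.of_map_inf h.map_inf

/-- An order isomorphism, seen as an isomorphism of the category. -/
def isoOfOrderIso (e : M ≃o N) : M ≅ N where
  hom := ⟨e, e.map_top, e.map_inf, fun _ _ _ h => e.isLUB_image'.2 h⟩
  inv := ⟨e.symm, e.symm.map_top, e.symm.map_inf, fun _ _ _ h => e.symm.isLUB_image'.2 h⟩
  hom_inv_id := Hom.ext (funext e.symm_apply_apply)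
  inv_hom_id := Hom.ext (funext e.apply_symm_apply)

end BDMSS

namespace KAlgFrmS

variable {L M : KAlgFrmS.{u}}

instance (L : KAlgFrmS.{u}) : OrderTop (CompactElt L) :=
  Subtype.orderTop L.isCompactElement_top

instance (L : KAlgFrmS.{u}) : BoundedOrder (CompactElt L) where

/-- The compact elements of a compact algebraic frame, ordered by the dual order. -/
def compacts (L : KAlgFrmS.{u}) : BDMSS.{u} where
  carrier := (CompactElt L)ᵒᵈ
  distrib _ _ _ := IsDistribInf.exists_inf_eq

namespace Hom

theorem map_sup (f : Hom L M) (a b : L) : f.toFun (a ⊔ b) = f.toFun a ⊔ f.toFun b := by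
  rw [← sSup_pair, f.map_sSup, Set.image_pair, sSup_pair]

theorem map_bot (f : Hom L M) : f.toFun ⊥ = ⊥ := by
  rw [← sSup_empty, f.map_sSup, Set.image_empty, sSup_empty]

/-- The restriction of a morphism to compact elements. -/
def onCompacts (f : Hom L M) (k : CompactElt L) : CompactElt M :=
  ⟨f.toFun k, f.map_compact k k.2⟩

theorem isGLB_onCompacts (f : Hom L M) {S : Set (CompactElt L)} {k : CompactElt L}
    (hS : S.Finite) (h : IsGLB S k) : IsGLB (f.onCompacts '' S) (f.onCompacts k) := by
  rw [CompactElt.isGLB_iff] at h ⊢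
  have hf := f.map_sInf (Subtype.val '' S) (hS.image _)
    (by rintro _ ⟨s, _, rfl⟩; exact s.2) (h ▸ k.2)
  simpa only [← h, Set.image_image, onCompacts] using hf

theorem ext_of_compacts {f g : Hom L M} (h : ∀ k : CompactElt L, f.toFun k = g.toFun k) :
    f = g := by
  refine Hom.ext (funext fun x => ?_)
  rw [← CompactElt.sSup_image_setOf_le x, f.map_sSup, g.map_sSup, Set.image_image,
    Set.image_image]
  simp only [h]

/-- The action of a morphism on the dual semilattices of compact elements. -/
def compactsMap (f : Hom L M) : BDMSS.Hom L.compacts M.compacts where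
  toFun k := OrderDual.toDual (f.onCompacts (OrderDual.ofDual k))
  map_top := congrArg OrderDual.toDual (Subtype.ext f.map_bot)
  map_inf _ _ := congrArg OrderDual.toDual (Subtype.ext (f.map_sup _ _))
  map_isLUB S k hS h := f.isGLB_onCompacts (S := S) (k := k) hS h

end Hom

/-- The functor sending a compact algebraic frame to the order dual of its compact elements. -/
def compactsFunctor : KAlgFrmS.{u} ⥤ BDMSS.{u} where
  obj := compacts
  map := Hom.compactsMap

instance : compactsFunctor.{u}.Faithful where
  map_injective h := Hom.ext_of_compacts fun k =>
    congrArg Subtype.val (congrFun (congrArg BDMSS.Hom.toFun h) (OrderDual.toDual k))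

/-- A sup-homomorphism between the dual semilattices of compact elements, seen as a map into the
codomain frame preserving finite joins. -/
def supBotHomOfCompacts (h : BDMSS.Hom L.compacts M.compacts) : SupBotHom (CompactElt L) M where
  toFun k := (OrderDual.ofDual (h.toFun (OrderDual.toDual k))).1
  map_sup' a b := congrArg Subtype.val (h.map_inf a b)
  map_bot' := congrArg Subtype.val h.map_top

/-- The extension to frames of a sup-homomorphism between compact elements. -/
def homOfCompacts (h : BDMSS.Hom L.compacts M.compacts) : Hom L M where
  toFun := CompactElt.lift (supBotHomOfCompacts h)
  map_sSup := map_sSup _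
  map_compact k hk := by
    rw [CompactElt.lift_coe _ ⟨k, hk⟩]
    exact (h.toFun (OrderDual.toDual ⟨k, hk⟩)).2
  map_sInf S hS hk hI := by
    lift S to Set (CompactElt L) using hk
    have hGLB : IsGLB (h.toFun '' S : Set (CompactElt M)) (h.toFun ⟨_, hI⟩ : CompactElt M) :=
      h.map_isLUB S _ (hS.of_finite_image Subtype.val_injective.injOn)
        (CompactElt.isGLB_iff.2 rfl)
    rw [CompactElt.lift_coe _ ⟨_, hI⟩, Set.image_image]
    simp only [CompactElt.lift_coe]
    exact (CompactElt.isGLB_iff.1 hGLB).trans (congrArg sInf (Set.image_image _ _ _))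

instance : compactsFunctor.{u}.Full where
  map_surjective h := ⟨homOfCompacts h, BDMSS.Hom.ext (funext fun k =>
    congrArg OrderDual.toDual (Subtype.ext (CompactElt.lift_coe (supBotHomOfCompacts h) k)))⟩

end KAlgFrmS

/-! ## The frame of ideals of a distributive join-semilattice -/

section Ideals

open Order.Ideal

variable {P : Type*} [SemilatticeSup P] [OrderBot P]

theorem mem_sSup_ideals_of_directedOn {S : Set (Order.Ideal P)} (hne : S.Nonempty)
    (hS : DirectedOn (· ≤ ·) S) {x : P} (hx : x ∈ sSup S) : ∃ I ∈ S, x ∈ I := by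
  let J : Order.Ideal P := (Order.isIdeal_sUnion_of_directedOn
    (C := SetLike.coe '' S) (by rintro _ ⟨I, _, rfl⟩; exact I.isIdeal) (directedOn_image.2 hS)
    (hne.image _)).toIdeal
  have hSJ : sSup S ≤ J := sSup_le fun I hI x hx => ⟨I, ⟨I, hI, rfl⟩, hx⟩
  obtain ⟨_, ⟨I, hI, rfl⟩, hxI⟩ := hSJ hx
  exact ⟨I, hI, hxI⟩

theorem isCompactElement_principal (p : P) : IsCompactElement (principal p) := by
  rw [CompleteLattice.isCompactElement_iff_le_of_directed_sSup_le]
  intro S hne hS h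
  obtain ⟨I, hI, hp⟩ := mem_sSup_ideals_of_directedOn hne hS (principal_le_iff.1 h)
  exact ⟨I, hI, principal_le_iff.2 hp⟩

theorem sSup_image_principal (I : Order.Ideal P) : sSup (principal '' (I : Set P)) = I := by
  refine le_antisymm (sSup_le ?_) fun x hx => principal_le_iff.1 (le_sSup ⟨x, hx, rfl⟩)
  rintro _ ⟨x, hx, rfl⟩
  exact principal_le_iff.2 hx

instance : IsCompactlyGenerated (Order.Ideal P) where
  exists_sSup_eq I := ⟨principal '' (I : Set P), by
    rintro _ ⟨p, _, rfl⟩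
    exact isCompactElement_principal p, sSup_image_principal I⟩

theorem isCompactElement_iff_exists_principal_eq {I : Order.Ideal P} :
    IsCompactElement I ↔ ∃ p, principal p = I := by
  refine ⟨fun h => ?_, by rintro ⟨p, rfl⟩; exact isCompactElement_principal p⟩
  have hmono : Monotone (principal : P → Order.Ideal P) :=
    fun _ _ h => principal_le_iff.2 (mem_principal.2 h)
  obtain ⟨_, ⟨p, hp, rfl⟩, hI⟩ :=
    (CompleteLattice.isCompactElement_iff_le_of_directed_sSup_le _ I).1 h (principal '' (I : Set P))
      (I.nonempty.image _) (.mono_comp hmono I.directed) (sSup_image_principal I).ge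
  exact ⟨p, le_antisymm (principal_le_iff.2 hp) hI⟩

/-- The elements of a join-semilattice are the compact elements of its lattice of ideals. -/
noncomputable def principalOrderIso : P ≃o CompactElt (Order.Ideal P) :=
  .ofSurjective (.ofMapLEIff (fun p => ⟨principal p, isCompactElement_principal p⟩)
      fun _ _ => principal_le_iff.trans mem_principal)
    fun I => (isCompactElement_iff_exists_principal_eq.1 I.2).imp fun _ => Subtype.ext

variable [IsDistribSup P]

/-- The Heyting implication of ideals: the largest ideal whose meet with `I` is below `J`. -/
def idealHimp (I J : Order.Ideal P) : Order.Ideal P where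
  carrier := {x | ∀ y ≤ x, y ∈ I → y ∈ J}
  lower' _ _ hyx hx z hz := hx z (hz.trans hyx)
  nonempty' := ⟨⊥, fun _ hy _ => J.lower hy J.bot_mem⟩
  directed' x hx y hy := by
    refine ⟨x ⊔ y, fun z hz hzI => ?_, le_sup_left, le_sup_right⟩
    obtain ⟨a, b, ha, hb, rfl⟩ := IsDistribSup.exists_sup_eq hz
    exact sup_mem (hx a ha (I.lower le_sup_left hzI)) (hy b hb (I.lower le_sup_right hzI))

theorem le_idealHimp_iff {I J K : Order.Ideal P} : K ≤ idealHimp I J ↔ K ⊓ I ≤ J :=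
  ⟨fun h _ hx => h hx.1 _ le_rfl hx.2, fun h _ hx _ hy hyI => h ⟨K.lower hy hx, hyI⟩⟩

instance : Order.Frame (Order.Ideal P) where
  __ := (inferInstance : CompleteLattice (Order.Ideal P))
  himp := idealHimp
  le_himp_iff _ _ _ := le_idealHimp_iff
  compl I := idealHimp I ⊥
  himp_bot _ := rfl

end Ideals

/-- The frame of filters of a bounded distributive meet-semilattice, encoded as ideals of the
order dual. -/
def BDMSS.filterFrame (M : BDMSS.{u}) : KAlgFrmS.{u} where
  carrier := Order.Ideal Mᵒᵈ
  isCompactElement_top :=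
    isCompactElement_iff_exists_principal_eq.2 ⟨⊤, Order.Ideal.principal_top⟩

namespace KAlgFrmS

instance : compactsFunctor.{u}.EssSurj where
  mem_essImage M :=
    ⟨M.filterFrame, ⟨BDMSS.isoOfOrderIso (principalOrderIso (P := Mᵒᵈ)).symm.dual⟩⟩

instance : compactsFunctor.{u}.IsEquivalence where

end KAlgFrmS

/-! ## Prime filters and optimal filters -/

section PrimeFilters

open Order

variable {M : Type*} [SemilatticeInf M]

theorem isPrime_of_infPrime [OrderTop M] {I : Ideal Mᵒᵈ} (hI : InfPrime I) :
    (⟨I⟩ : PFilter M).IsPrime where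
  compl_ideal := by
    refine ⟨fun a b hba ha hb => ha (I.lower hba hb), ?_, fun a ha b hb => ?_⟩
    · exact Set.nonempty_compl.2 fun h =>
        hI.1 fun J _ a _ => Set.eq_univ_iff_forall.1 h (OrderDual.ofDual a)
    · have hab : ¬Ideal.principal (OrderDual.toDual a) ⊓ Ideal.principal (OrderDual.toDual b) ≤ I :=
        fun h => (hI.2 h).elim (fun h => ha (Ideal.principal_le_iff.1 h))
          fun h => hb (Ideal.principal_le_iff.1 h)
      obtain ⟨d, ⟨had, hbd⟩, hd⟩ := SetLike.not_le_iff_exists.1 hab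
      exact ⟨d, hd, had, hbd⟩

theorem exists_isPrime_of_notMem [OrderTop M] [IsDistribInf M] {F : PFilter M} {c : M}
    (hc : c ∉ F) : ∃ G, F ≤ G ∧ G.IsPrime ∧ c ∉ G := by
  obtain ⟨I, hFI, hcI, hI⟩ := exists_infPrime_of_isCompactElement_of_not_le
    (isCompactElement_principal (OrderDual.toDual c)) (a := F.dual)
    (fun h => hc (Ideal.principal_le_iff.1 h))
  exact ⟨⟨I⟩, hFI, isPrime_of_infPrime hI, fun h => hcI (Ideal.principal_le_iff.2 h)⟩

theorem exists_isPrime_of_not_le [OrderTop M] [IsDistribInf M] {a b : M} (h : ¬a ≤ b) :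
    ∃ G : PFilter M, a ∈ G ∧ G.IsPrime ∧ b ∉ G := by
  obtain ⟨G, haG, hG, hbG⟩ := exists_isPrime_of_notMem (F := PFilter.principal a) h
  exact ⟨G, PFilter.principal_le_iff.1 haG, hG, hbG⟩

/-- A filter is optimal if its complement is a Frink ideal: it contains a member of every finite
set `S` for which it contains an element lying below all upper bounds of `S`. The case `S = ∅`
excludes a least element from `F`. -/
def IsOptimal {M : Type*} [Preorder M] (F : PFilter M) : Prop :=
  ∀ ⦃S : Set M⦄, S.Finite → ∀ ⦃b : M⦄, b ∈ lowerBounds (upperBounds S) → b ∈ F → ∃ s ∈ S, s ∈ F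

theorem isOptimal_of_isPrime {M : Type*} [Preorder M] {F : PFilter M} (hF : F.IsPrime) :
    IsOptimal F := by
  intro S hS b hb hbF
  by_contra! h
  obtain ⟨u, hu, hSu⟩ := exists_mem_forall_rel_of_finite hF.compl_ideal.Directed
    hF.compl_ideal.Nonempty hS h
  exact hu (PFilter.mem_of_le (hb hSu) hbF)

theorem isLUB_image_inf [OrderTop M] [IsDistribInf M] {S : Set M} (hS : S.Finite) {b : M}
    (hb : b ∈ lowerBounds (upperBounds S)) : IsLUB ((b ⊓ ·) '' S) b := by
  refine ⟨?_, fun c hc => ?_⟩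
  · rintro _ ⟨s, _, rfl⟩
    exact inf_le_left
  · by_contra h
    obtain ⟨F, hbF, hF, hcF⟩ := exists_isPrime_of_not_le h
    obtain ⟨s, hs, hsF⟩ := isOptimal_of_isPrime hF hS hb hbF
    exact hcF (PFilter.mem_of_le (hc ⟨s, hs, rfl⟩) (PFilter.inf_mem hbF hsF))

end PrimeFilters

/-! ## The space of optimal filters -/

/-- The optimal filters of `M`, the points of the dual space. -/
structure OptimalFilter (M : Type*) [Preorder M] extends Order.PFilter M where
  isOptimal : IsOptimal toPFilter

namespace OptimalFilter

section Preorder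

variable {M : Type*} [Preorder M] {x y : OptimalFilter M} {a b : M}

instance : SetLike (OptimalFilter M) M where
  coe x := x.toPFilter
  coe_injective := by
    rintro ⟨F, _⟩ ⟨G, _⟩ h
    obtain rfl : F = G := SetLike.coe_injective h
    rfl

instance : PartialOrder (OptimalFilter M) := .ofSetLike (OptimalFilter M) M

theorem mem_of_le (hab : a ≤ b) (ha : a ∈ x) : b ∈ x := Order.PFilter.mem_of_le hab ha

theorem bot_notMem [OrderBot M] (x : OptimalFilter M) : ⊥ ∉ x := fun hx => by
  obtain ⟨s, hs, _⟩ := x.isOptimal Set.finite_empty (fun _ _ => bot_le) hx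
  exact hs

/-- The optimal filters containing `a`. -/
def basicClopen (a : M) : Set (OptimalFilter M) := {x | a ∈ x}

@[simp]
theorem mem_basicClopen : x ∈ basicClopen a ↔ a ∈ x := Iff.rfl

/-- The patch topology, generated by the sets `basicClopen a` and their complements. -/
instance : TopologicalSpace (OptimalFilter M) :=
  .generateFrom (Set.range basicClopen ∪ Set.range fun a => (basicClopen a)ᶜ)

theorem isClopen_basicClopen (a : M) : IsClopen (basicClopen a) :=
  ⟨isOpen_compl_iff.1 (.basic _ (.inr ⟨a, rfl⟩)), .basic _ (.inl ⟨a, rfl⟩)⟩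

theorem isUpperSet_basicClopen (a : M) : IsUpperSet (basicClopen a) :=
  fun _ _ hxy hx => hxy hx

instance : PriestleySpace (OptimalFilter M) where
  priestley {x y} h := by
    obtain ⟨a, hax, hay⟩ := SetLike.not_le_iff_exists.1 h
    exact ⟨basicClopen a, isClopen_basicClopen a, isUpperSet_basicClopen a, hax, hay⟩

variable (M) in
/-- The points given by prime filters. -/
def primes : Set (OptimalFilter M) := {x | x.toPFilter.IsPrime}

end Preorder

section SemilatticeInf

variable {M : Type*} [SemilatticeInf M] {x : OptimalFilter M} {a b : M}

theorem inf_mem_iff : a ⊓ b ∈ x ↔ a ∈ x ∧ b ∈ x := Order.PFilter.inf_mem_iff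

variable [OrderTop M]

theorem top_mem : ⊤ ∈ x := Order.PFilter.top_mem

/-- The limit of an ultrafilter on the space of optimal filters: the filter of those `a` for which
the ultrafilter concentrates on `basicClopen a`. -/
def ultrafilterLim (𝒰 : Ultrafilter (OptimalFilter M)) : OptimalFilter M where
  toPFilter := (Order.IsPFilter.of_def (F := {a | ∀ᶠ x in (𝒰 : Filter (OptimalFilter M)), a ∈ x})
    ⟨⊤, .of_forall fun _ => top_mem⟩
    (fun a ha b hb => ⟨a ⊓ b, (ha.and hb).mono fun _ => inf_mem_iff.2, inf_le_left, inf_le_right⟩)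
    (fun hab ha => ha.mono fun _ => mem_of_le hab)).toPFilter
  isOptimal _ hS _ hb hb𝒰 :=
    (Ultrafilter.eventually_exists_mem_iff hS).1 <| hb𝒰.mono fun x => x.isOptimal hS hb

theorem le_nhds_ultrafilterLim (𝒰 : Ultrafilter (OptimalFilter M)) :
    ↑𝒰 ≤ nhds (ultrafilterLim 𝒰) := by
  rw [TopologicalSpace.nhds_generateFrom]
  refine le_iInf₂ fun U hU => Filter.le_principal_iff.2 ?_
  obtain ⟨hx, ⟨a, rfl⟩ | ⟨a, rfl⟩⟩ := hU
  · exact hx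
  · exact Ultrafilter.eventually_not.2 hx

instance : CompactSpace (OptimalFilter M) where
  isCompact_univ := isCompact_iff_ultrafilter_le_nhds.2 fun 𝒰 _ =>
    ⟨ultrafilterLim 𝒰, Set.mem_univ _, le_nhds_ultrafilterLim 𝒰⟩

theorem exists_basicClopen_of_mem_isOpen {O : Set (OptimalFilter M)} (hO : IsOpen O)
    (hx : x ∈ O) : ∃ a ∈ x, ∃ S : Set M, S.Finite ∧ (∀ s ∈ S, s ∉ x) ∧
      ∀ y : OptimalFilter M, a ∈ y → (∀ s ∈ S, s ∉ y) → y ∈ O := by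
  induction hO with
  | basic U hU =>
    obtain ⟨a, rfl⟩ | ⟨a, rfl⟩ := hU
    · exact ⟨a, hx, ∅, Set.finite_empty, by simp, fun _ hy _ => hy⟩
    · exact ⟨⊤, top_mem, {a}, Set.finite_singleton a, by simpa using hx, by simp⟩
  | univ => exact ⟨⊤, top_mem, ∅, Set.finite_empty, by simp, by simp⟩
  | inter U V _ _ ihU ihV =>
    obtain ⟨a, ha, S, hS, hSx, hU⟩ := ihU hx.1
    obtain ⟨b, hb, T, hT, hTx, hV⟩ := ihV hx.2
    refine ⟨a ⊓ b, inf_mem_iff.2 ⟨ha, hb⟩, S ∪ T, hS.union hT,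
      fun s hs => hs.elim (hSx s) (hTx s), fun y hab hy => ?_⟩
    rw [inf_mem_iff] at hab
    exact ⟨hU y hab.1 fun s hs => hy s (.inl hs), hV y hab.2 fun s hs => hy s (.inr hs)⟩
  | sUnion 𝒪 _ ih =>
    obtain ⟨U, hU, hxU⟩ := hx
    obtain ⟨a, ha, S, hS, hSx, hy⟩ := ih U hU hxU
    exact ⟨a, ha, S, hS, hSx, fun y hay hSy => ⟨U, hU, hy y hay hSy⟩⟩

theorem dense_of_forall_exists {D : Set (OptimalFilter M)}
    (hD : ∀ (a : M) (S : Set M), S.Finite → a ∉ lowerBounds (upperBounds S) →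
      ∃ y ∈ D, a ∈ y ∧ ∀ s ∈ S, s ∉ y) : Dense D := by
  refine fun x => mem_closure_iff.2 fun O hO hx => ?_
  obtain ⟨a, ha, S, hS, hSx, hOy⟩ := exists_basicClopen_of_mem_isOpen hO hx
  obtain ⟨y, hyD, hay, hSy⟩ := hD a S hS fun haS => by
    obtain ⟨s, hs, hsx⟩ := x.isOptimal hS haS ha
    exact hSx s hs hsx
  exact ⟨y, hOy y hay hSy, hyD⟩

variable [IsDistribInf M]

theorem basicClopen_subset_basicClopen : basicClopen a ⊆ basicClopen b ↔ a ≤ b := by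
  refine ⟨fun h => ?_, fun h x => mem_of_le h⟩
  by_contra hab
  obtain ⟨F, haF, hF, hbF⟩ := exists_isPrime_of_not_le hab
  exact hbF (h (show ⟨F, isOptimal_of_isPrime hF⟩ ∈ basicClopen a from haF))

theorem basicClopen_injective : Function.Injective (basicClopen (M := M)) := fun _ _ h =>
  le_antisymm (basicClopen_subset_basicClopen.1 h.subset)
    (basicClopen_subset_basicClopen.1 h.superset)

theorem dense_primes : Dense (primes M) :=
  dense_of_forall_exists fun a S _ haS => by
    simp only [mem_lowerBounds, not_forall] at haS
    obtain ⟨u, hSu, hau⟩ := haS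
    obtain ⟨F, haF, hF, huF⟩ := exists_isPrime_of_not_le hau
    exact ⟨⟨F, isOptimal_of_isPrime hF⟩, hF, haF,
      fun s hs hsF => huF (Order.PFilter.mem_of_le (hSu hs) hsF)⟩

theorem exists_mem_primes_of_notMem (ha : a ∉ x) : ∃ y ∈ primes M, x ≤ y ∧ a ∉ y := by
  obtain ⟨G, hxG, hG, haG⟩ := exists_isPrime_of_notMem ha
  exact ⟨⟨G, isOptimal_of_isPrime hG⟩, hG, hxG, haG⟩

end SemilatticeInf

end OptimalFilter

/-! ## Admissible clopen upsets of the dual space -/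

instance {X : Type*} [TopologicalSpace X] [Preorder X] [PriestleySpace X] :
    ClosedIciTopology X where
  isClosed_Ici x := by
    refine isOpen_compl_iff.1 (isOpen_iff_forall_mem_open.2 fun y hy => ?_)
    obtain ⟨U, hU, hUup, hxU, hyU⟩ := exists_isClopen_upper_of_not_le hy
    exact ⟨Uᶜ, fun z hz hxz => hz (hUup hxz hxU), hU.compl.isOpen, hyU⟩

theorem exists_le_maximal_of_isCompact {X : Type*} [TopologicalSpace X] [PartialOrder X]
    [ClosedIciTopology X] {K : Set X} (hK : IsCompact K) {x : X} (hx : x ∈ K) :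
    ∃ m, x ≤ m ∧ Maximal (· ∈ K) m := by
  refine zorn_le_nonempty₀ K (fun c hcK hc z hz => ?_) x hx
  obtain ⟨y, hyK, hy⟩ := hK.inter_iInter_nonempty (fun a : c => Set.Ici (a : X))
    (fun _ => isClosed_Ici) fun t => by
      obtain ⟨m, hm, htm⟩ := exists_mem_forall_rel_of_finite hc.directedOn ⟨z, hz⟩
        (t.finite_toSet.image Subtype.val) (by rintro _ ⟨a, _, rfl⟩; exact a.2)
      exact ⟨m, hcK hm, Set.mem_iInter₂.2 fun a ha => htm a ⟨a, ha, rfl⟩⟩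
  exact ⟨y, hyK, fun a ha => Set.mem_iInter.1 hy ⟨a, ha⟩⟩

namespace OptimalFilter

theorem exists_subset_basicClopen_of_notMem_of_mem_primes {M : Type*} [Preorder M]
    {U : Set (OptimalFilter M)} (hU : IsCompact U) (hUup : IsUpperSet U) {x : OptimalFilter M}
    (hxU : x ∉ U) (hx : x ∈ primes M) : ∃ a ∉ x, U ⊆ basicClopen a := by
  have : Nonempty {a // a ∉ x} := hx.compl_ideal.Nonempty.to_subtype
  obtain ⟨a, haU⟩ := hU.elim_directed_cover (fun a : {a // a ∉ x} => basicClopen a.1)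
    (fun a => (isClopen_basicClopen a.1).isOpen)
    (fun z hz => by
      obtain ⟨a, haz, hax⟩ := SetLike.not_le_iff_exists.1 fun hzx => hxU (hUup hzx hz)
      exact Set.mem_iUnion.2 ⟨⟨a, hax⟩, haz⟩)
    (fun a b => by
      obtain ⟨d, hd, had, hbd⟩ := hx.compl_ideal.Directed a.1 a.2 b.1 b.2
      exact ⟨⟨d, hd⟩, fun _ => mem_of_le had, fun _ => mem_of_le hbd⟩)
  exact ⟨a.1, a.2, haU⟩

variable {M : Type u} [SemilatticeInf M] [OrderTop M]

theorem exists_subset_basicClopen_of_notMem {U : Set (OptimalFilter M)}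
    (hU : IsAdmissible (primes M) U) {y : OptimalFilter M} (hy : y ∉ U) :
    ∃ a ∉ y, U ⊆ basicClopen a := by
  obtain ⟨x, hyx, hx⟩ := exists_le_maximal_of_isCompact hU.1.compl.isClosed.isCompact hy
  obtain ⟨a, hax, haU⟩ := exists_subset_basicClopen_of_notMem_of_mem_primes
    hU.1.isClosed.isCompact hU.2.1 hx.1 (hU.2.2 x hx)
  exact ⟨a, fun hay => hax (hyx hay), haU⟩

variable [IsDistribInf M]

theorem isAdmissible_basicClopen (a : M) : IsAdmissible (primes M) (basicClopen a) := by
  refine ⟨isClopen_basicClopen a, isUpperSet_basicClopen a, fun x hx => ?_⟩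
  obtain ⟨y, hy, hxy, hay⟩ := exists_mem_primes_of_notMem hx.1
  rwa [le_antisymm hxy (hx.2 hay hxy)]

theorem isAdmissible_iff {U : Set (OptimalFilter M)} :
    IsAdmissible (primes M) U ↔ ∃ a, basicClopen a = U := by
  refine ⟨fun hU => ?_, by rintro ⟨a, rfl⟩; exact isAdmissible_basicClopen a⟩
  have : Nonempty {a : M // U ⊆ basicClopen a} := ⟨⊤, fun _ _ => top_mem⟩
  obtain ⟨a, ha⟩ := hU.1.compl.isClosed.isCompact.elim_directed_cover
    (fun a : {a : M // U ⊆ basicClopen a} => (basicClopen a.1)ᶜ)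
    (fun a => (isClopen_basicClopen a.1).compl.isOpen)
    (fun y hy => by
      obtain ⟨a, hay, haU⟩ := exists_subset_basicClopen_of_notMem hU hy
      exact Set.mem_iUnion.2 ⟨⟨a, haU⟩, hay⟩)
    (fun a b => ⟨⟨a.1 ⊓ b.1, fun x hx => inf_mem_iff.2 ⟨a.2 hx, b.2 hx⟩⟩,
      fun _ hx h => hx (inf_mem_iff.1 h).1, fun _ hx h => hx (inf_mem_iff.1 h).2⟩)
  exact ⟨a.1, (Set.compl_subset_compl.1 ha).antisymm a.2⟩

theorem mem_primes_iff [OrderBot M] {x : OptimalFilter M} :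
    x ∈ primes M ↔ DirectedOn (· ⊆ ·) (admissibleMissing (primes M) x) := by
  constructor
  · rintro hx U ⟨hU, hxU⟩ V ⟨hV, hxV⟩
    obtain ⟨a, rfl⟩ := isAdmissible_iff.1 hU
    obtain ⟨b, rfl⟩ := isAdmissible_iff.1 hV
    obtain ⟨d, hd, had, hbd⟩ := hx.compl_ideal.Directed a hxU b hxV
    exact ⟨basicClopen d, ⟨isAdmissible_basicClopen d, hd⟩,
      basicClopen_subset_basicClopen.2 had, basicClopen_subset_basicClopen.2 hbd⟩
  · refine fun h => ⟨fun _ _ hba ha hb => ha (mem_of_le hba hb), ⟨⊥, x.bot_notMem⟩,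
      fun a ha b hb => ?_⟩
    obtain ⟨_, ⟨hU, hxU⟩, haU, hbU⟩ :=
      h _ ⟨isAdmissible_basicClopen a, ha⟩ _ ⟨isAdmissible_basicClopen b, hb⟩
    obtain ⟨d, rfl⟩ := isAdmissible_iff.1 hU
    exact ⟨d, hxU, basicClopen_subset_basicClopen.1 haU, basicClopen_subset_basicClopen.1 hbU⟩

end OptimalFilter

/-! ## The functor of optimal filters -/

namespace BDMSS

open OptimalFilter

variable {M N : BDMSS.{u}}

/-- The generalized Priestley space of optimal filters, in which `X₀` consists of the prime
filters. -/
def spec (M : BDMSS.{u}) : GPSS.{u} where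
  carrier := OptimalFilter M
  X₀ := primes M
  dense := dense_primes
  order_dense x := by
    obtain ⟨y, hy, hxy, _⟩ := exists_mem_primes_of_notMem x.bot_notMem
    exact ⟨y, hy, hxy⟩
  mem_iff_directed _ := mem_primes_iff
  le_iff x y := ⟨fun h _ hU hx => hU.2.1 h hx,
    fun h a hx => h _ (isAdmissible_basicClopen a) hx⟩

/-- The preimage of an optimal filter under a sup-homomorphism. -/
def Hom.comap (h : Hom M N) (x : OptimalFilter N) : OptimalFilter M where
  toPFilter := (Order.IsPFilter.of_def (F := {a | h.toFun a ∈ x})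
    ⟨⊤, show h.toFun ⊤ ∈ x from h.map_top ▸ top_mem⟩
    (fun a ha b hb => ⟨a ⊓ b, show h.toFun (a ⊓ b) ∈ x from h.map_inf a b ▸ inf_mem_iff.2 ⟨ha, hb⟩,
      inf_le_left, inf_le_right⟩)
    (fun hab => mem_of_le (h.monotone hab))).toPFilter
  isOptimal S hS b hb hbx := by
    have hLUB := h.map_isLUB _ b (hS.image _) (isLUB_image_inf hS hb)
    obtain ⟨_, ⟨_, ⟨s, hs, rfl⟩, rfl⟩, hsx⟩ := x.isOptimal ((hS.image _).image _) hLUB.2 hbx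
    exact ⟨s, hs, mem_of_le (h.monotone inf_le_right) hsx⟩

/-- The functor sending a bounded distributive meet-semilattice to its space of optimal filters. -/
def specFunctor : BDMSS.{u}ᵒᵖ ⥤ GPSS.{u} where
  obj M := M.unop.spec
  map h :=
    { toFun := h.unop.comap
      monotone := fun _ _ hxy _ ha => hxy ha
      preimage_admissible := fun U hU => by
        obtain ⟨a, rfl⟩ := isAdmissible_iff.1 hU
        exact isAdmissible_basicClopen (h.unop.toFun a) }

instance : specFunctor.{u}.Faithful where
  map_injective {N M} f g h := by
    refine Quiver.Hom.unop_inj <| Hom.ext <| funext fun a =>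
      basicClopen_injective <| Set.ext fun x => ?_
    have hfg : f.unop.comap x = g.unop.comap x := congrFun (congrArg GPSS.Hom.toFun h) x
    exact SetLike.ext_iff.1 hfg a

/-- The sup-homomorphism dual to a strong Priestley morphism `f`, given the action `h` of `f` on
admissible clopen upsets. -/
def homOfMemIff (f : OptimalFilter N → OptimalFilter M) (h : M → N)
    (hf : ∀ x a, h a ∈ x ↔ a ∈ f x) : Hom M N where
  toFun := h
  map_top := basicClopen_injective <| Set.ext fun x => by simp [hf, top_mem]
  map_inf a b := basicClopen_injective <| Set.ext fun x => by simp [hf, inf_mem_iff]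
  map_isLUB S a hS ha := by
    refine ⟨?_, fun c hc => basicClopen_subset_basicClopen.1 fun x hx => ?_⟩
    · rintro _ ⟨s, hs, rfl⟩
      exact basicClopen_subset_basicClopen.1 fun x hx =>
        (hf x a).2 (mem_of_le (ha.1 hs) ((hf x s).1 hx))
    · obtain ⟨s, hs, hsx⟩ := (f x).isOptimal hS ha.2 ((hf x a).1 hx)
      exact mem_of_le (hc ⟨s, hs, rfl⟩) ((hf x s).2 hsx)

instance : specFunctor.{u}.Full where
  map_surjective {N M} f := by
    choose h hh using fun a : M.unop =>
      isAdmissible_iff.1 (f.preimage_admissible _ (isAdmissible_basicClopen a))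
    let φ : OptimalFilter N.unop → OptimalFilter M.unop := f.toFun
    have hf : ∀ x a, h a ∈ x ↔ a ∈ φ x := fun x a => Set.ext_iff.1 (hh a) x
    have hφ : (homOfMemIff φ h hf).comap = φ := funext fun x => SetLike.ext (hf x)
    exact ⟨Quiver.Hom.op (homOfMemIff φ h hf), GPSS.Hom.ext hφ⟩

end BDMSS

/-! ## The semilattice of admissible clopen upsets -/

namespace IsAdmissible

variable {X : Type u} [TopologicalSpace X] [PartialOrder X] {X₀ U V : Set X}

theorem inter (hU : IsAdmissible X₀ U) (hV : IsAdmissible X₀ V) : IsAdmissible X₀ (U ∩ V) := by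
  refine ⟨hU.1.inter hV.1, hU.2.1.inter hV.2.1, fun x hx => ?_⟩
  by_cases hxU : x ∈ U
  · exact hV.2.2 x ⟨fun hxV => hx.1 ⟨hxU, hxV⟩, fun y hy hxy => hx.2 (fun h => hy h.2) hxy⟩
  · exact hU.2.2 x ⟨hxU, fun y hy hxy => hx.2 (fun h => hy h.1) hxy⟩

theorem univ : IsAdmissible X₀ Set.univ :=
  ⟨isClopen_univ, isUpperSet_univ, fun _ hx => absurd (Set.mem_univ _) hx.1⟩

theorem empty (h : ∀ x : X, ∃ y ∈ X₀, x ≤ y) : IsAdmissible X₀ ∅ := by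
  refine ⟨isClopen_empty, isUpperSet_empty, fun x hx => ?_⟩
  obtain ⟨y, hy, hxy⟩ := h x
  rwa [le_antisymm hxy (hx.2 (Set.notMem_empty y) hxy)]

end IsAdmissible

namespace GPSS

variable {X : GPSS.{u}}

theorem exists_isAdmissible_union_subset {x : X} (hx : x ∈ X.X₀) {U V : Set X}
    (hU : IsAdmissible X.X₀ U) (hxU : x ∉ U) (hV : IsAdmissible X.X₀ V) (hxV : x ∉ V) :
    ∃ W, IsAdmissible X.X₀ W ∧ x ∉ W ∧ U ∪ V ⊆ W := by
  obtain ⟨W, ⟨hW, hxW⟩, hUW, hVW⟩ := (X.mem_iff_directed x).1 hx U ⟨hU, hxU⟩ V ⟨hV, hxV⟩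
  exact ⟨W, hW, hxW, Set.union_subset hUW hVW⟩

theorem exists_isAdmissible_notMem_inter {U V W : Set X} (hU : IsAdmissible X.X₀ U)
    (hV : IsAdmissible X.X₀ V) (hW : IsAdmissible X.X₀ W) (h : U ∩ V ⊆ W) {y : X} (hy : y ∉ W) :
    ∃ U' V', IsAdmissible X.X₀ U' ∧ IsAdmissible X.X₀ V' ∧ U ∪ W ⊆ U' ∧ V ∪ W ⊆ V' ∧
      y ∉ U' ∩ V' := by
  obtain ⟨x, hyx, hx⟩ := exists_le_maximal_of_isCompact hW.1.compl.isClosed.isCompact hy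
  have hx₀ : x ∈ X.X₀ := hW.2.2 x hx
  by_cases hxU : x ∈ U
  · obtain ⟨V', hV', hxV', hVV'⟩ :=
      exists_isAdmissible_union_subset hx₀ hV (fun hxV => hx.1 (h ⟨hxU, hxV⟩)) hW hx.1
    exact ⟨Set.univ, V', .univ, hV', Set.subset_univ _, hVV', fun hy' => hxV' (hV'.2.1 hyx hy'.2)⟩
  · obtain ⟨U', hU', hxU', hUU'⟩ := exists_isAdmissible_union_subset hx₀ hU hxU hW hx.1
    exact ⟨U', Set.univ, hU', .univ, hUU', Set.subset_univ _, fun hy' => hxU' (hU'.2.1 hyx hy'.1)⟩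

theorem exists_isAdmissible_inter_eq {U V W : Set X} (hU : IsAdmissible X.X₀ U)
    (hV : IsAdmissible X.X₀ V) (hW : IsAdmissible X.X₀ W) (h : U ∩ V ⊆ W) :
    ∃ U' V', IsAdmissible X.X₀ U' ∧ IsAdmissible X.X₀ V' ∧ U ⊆ U' ∧ V ⊆ V' ∧ U' ∩ V' = W := by
  obtain ⟨U', V', hU', hV', hUU', hVV', hdisj⟩ := hW.1.compl.isClosed.isCompact.induction_on
    (p := fun K => ∃ U' V', IsAdmissible X.X₀ U' ∧ IsAdmissible X.X₀ V' ∧ U ∪ W ⊆ U' ∧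
      V ∪ W ⊆ V' ∧ Disjoint K (U' ∩ V'))
    ⟨Set.univ, Set.univ, .univ, .univ, Set.subset_univ _, Set.subset_univ _, Set.empty_disjoint _⟩
    (by
      rintro K L hKL ⟨U', V', hU', hV', hUU', hVV', hL⟩
      exact ⟨U', V', hU', hV', hUU', hVV', hL.mono_left hKL⟩)
    (by
      rintro K L ⟨U₁, V₁, hU₁, hV₁, hUU₁, hVV₁, hK⟩ ⟨U₂, V₂, hU₂, hV₂, hUU₂, hVV₂, hL⟩
      exact ⟨U₁ ∩ U₂, V₁ ∩ V₂, hU₁.inter hU₂, hV₁.inter hV₂, Set.subset_inter hUU₁ hUU₂,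
        Set.subset_inter hVV₁ hVV₂, Set.disjoint_union_left.2
          ⟨hK.mono_right (Set.inter_subset_inter Set.inter_subset_left Set.inter_subset_left),
            hL.mono_right (Set.inter_subset_inter Set.inter_subset_right Set.inter_subset_right)⟩⟩)
    (fun y hy => by
      obtain ⟨U', V', hU', hV', hUU', hVV', hyUV⟩ :=
        exists_isAdmissible_notMem_inter hU hV hW h hy
      exact ⟨(U' ∩ V')ᶜ, mem_nhdsWithin_of_mem_nhds
        ((hU'.1.inter hV'.1).compl.isOpen.mem_nhds hyUV), U', V', hU', hV', hUU', hVV',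
        disjoint_compl_left⟩)
  rw [Set.union_subset_iff] at hUU' hVV'
  exact ⟨U', V', hU', hV', hUU'.1, hVV'.1, (Set.disjoint_compl_left_iff_subset.1 hdisj).antisymm
    (Set.subset_inter hUU'.2 hVV'.2)⟩

/-- The bounded distributive meet-semilattice of admissible clopen upsets. -/
def admissibles (X : GPSS.{u}) : BDMSS.{u} where
  carrier := {U : Set X // IsAdmissible X.X₀ U}
  semilatticeInf := Subtype.semilatticeInf fun {_ _} hU hV => IsAdmissible.inter hU hV
  boundedOrder :=
    { top := ⟨Set.univ, .univ⟩
      le_top := fun U => Set.subset_univ U.1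
      bot := ⟨∅, .empty X.order_dense⟩
      bot_le := fun U => Set.empty_subset U.1 }
  distrib U V W h := by
    obtain ⟨U', V', hU', hV', hUU', hVV', hW⟩ := exists_isAdmissible_inter_eq U.2 V.2 W.2 h
    exact ⟨⟨U', hU'⟩, ⟨V', hV'⟩, hUU', hVV', Subtype.ext hW⟩

theorem exists_upperBound_notMem {S : Set X.admissibles} (hS : S.Finite) {x : X} (hx : x ∈ X.X₀)
    (hxS : ∀ V ∈ S, x ∉ V.1) : ∃ W ∈ upperBounds S, x ∉ W.1 := by
  obtain ⟨W, ⟨hW, hxW⟩, hSW⟩ := exists_mem_forall_rel_of_finite ((X.mem_iff_directed x).1 hx)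
    ⟨∅, .empty X.order_dense, Set.notMem_empty x⟩ (hS.image Subtype.val)
    (by rintro _ ⟨V, hV, rfl⟩; exact ⟨V.2, hxS V hV⟩)
  exact ⟨⟨W, hW⟩, fun V hV => hSW V.1 ⟨V, hV, rfl⟩, hxW⟩

theorem mem_lowerBounds_upperBounds_iff {S : Set X.admissibles} (hS : S.Finite)
    {U : X.admissibles} : U ∈ lowerBounds (upperBounds S) ↔ U.1 ⊆ ⋃ V ∈ S, V.1 := by
  refine ⟨fun hU => ?_, fun hU W hW => hU.trans (Set.iUnion₂_subset fun V hV => hW hV)⟩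
  by_contra hUS
  have hopen : IsOpen (U.1 \ ⋃ V ∈ S, V.1) :=
    U.2.1.isOpen.sdiff (hS.isClosed_biUnion fun V _ => V.2.1.isClosed)
  obtain ⟨y, ⟨hyU, hyS⟩, hy⟩ :=
    X.dense.inter_open_nonempty _ hopen (Set.sdiff_nonempty.2 hUS)
  obtain ⟨W, hSW, hyW⟩ :=
    exists_upperBound_notMem hS hy fun V hV hyV => hyS (Set.mem_biUnion hV hyV)
  exact hyW (hU hSW hyU)

/-- The optimal filter of admissible clopen upsets containing a point. -/
def toSpec (x : X) : OptimalFilter X.admissibles where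
  toPFilter := (Order.IsPFilter.of_def (F := {U : X.admissibles | x ∈ U.1}) ⟨⊤, Set.mem_univ x⟩
    (fun U hU V hV => ⟨U ⊓ V, ⟨hU, hV⟩, inf_le_left, inf_le_right⟩)
    (fun hUV hU => hUV hU)).toPFilter
  isOptimal S hS U hU hx := by
    obtain ⟨V, hV, hxV⟩ := Set.mem_iUnion₂.1 ((mem_lowerBounds_upperBounds_iff hS).1 hU hx)
    exact ⟨V, hV, hxV⟩

theorem mem_toSpec {x : X} {U : X.admissibles} : U ∈ toSpec x ↔ x ∈ U.1 := Iff.rfl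

theorem toSpec_le_iff {x y : X} : toSpec x ≤ toSpec y ↔ x ≤ y :=
  Subtype.forall.trans (X.le_iff x y).symm

open OptimalFilter

theorem continuous_toSpec : Continuous (toSpec (X := X)) := by
  refine continuous_generateFrom_iff.2 ?_
  rintro _ (⟨U, rfl⟩ | ⟨U, rfl⟩)
  · exact U.2.1.isOpen
  · exact U.2.1.compl.isOpen

theorem denseRange_toSpec : DenseRange (toSpec (X := X)) :=
  dense_of_forall_exists fun U S hS hUS => by
    obtain ⟨x, hxU, hxS⟩ := Set.not_subset.1 (mt (mem_lowerBounds_upperBounds_iff hS).2 hUS)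
    exact ⟨toSpec x, ⟨x, rfl⟩, hxU, fun V hV hxV => hxS (Set.mem_biUnion hV hxV)⟩

theorem toSpec_surjective : Function.Surjective (toSpec (X := X)) :=
  Set.range_eq_univ.1 <|
    (isCompact_range continuous_toSpec).isClosed.closure_eq ▸ denseRange_toSpec.closure_range

/-- A generalized Priestley space is order isomorphic to the space of optimal filters of its
admissible clopen upsets. -/
noncomputable def orderIsoSpec (X : GPSS.{u}) : X ≃o OptimalFilter X.admissibles :=
  .ofSurjective (.ofMapLEIff toSpec fun _ _ => toSpec_le_iff) toSpec_surjective

theorem symm_orderIsoSpec_mem_iff {F : OptimalFilter X.admissibles} {U : X.admissibles} :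
    X.orderIsoSpec.symm F ∈ U.1 ↔ U ∈ F := by
  have hF : toSpec (X.orderIsoSpec.symm F) = F := X.orderIsoSpec.apply_symm_apply F
  rw [← mem_toSpec, hF]

/-- The isomorphism of generalized Priestley spaces underlying the order isomorphism
`orderIsoSpec`. -/
noncomputable def isoSpec (X : GPSS.{u}) : X.admissibles.spec ≅ X where
  hom :=
    { toFun := X.orderIsoSpec.symm
      monotone := X.orderIsoSpec.symm.monotone
      preimage_admissible := fun U hU =>
        isAdmissible_iff.2 ⟨⟨U, hU⟩, Set.ext fun _ => symm_orderIsoSpec_mem_iff.symm⟩ }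
  inv :=
    { toFun := X.orderIsoSpec
      monotone := X.orderIsoSpec.monotone
      preimage_admissible := fun U hU => by
        obtain ⟨V, rfl⟩ := isAdmissible_iff.1 hU
        exact V.2 }
  hom_inv_id := GPSS.Hom.ext (funext X.orderIsoSpec.apply_symm_apply)
  inv_hom_id := GPSS.Hom.ext (funext X.orderIsoSpec.symm_apply_apply)

end GPSS

namespace BDMSS

instance : specFunctor.{u}.EssSurj where
  mem_essImage X := ⟨Opposite.op X.admissibles, ⟨X.isoSpec⟩⟩

instance : specFunctor.{u}.IsEquivalence where

end BDMSS

theorem mainTheorem5 :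
    Nonempty (KAlgFrmS.{u} ≌ BDMSS.{u}) ∧
    Nonempty (KAlgFrmS.{u}ᵒᵖ ≌ GPSS.{u}) ∧
    Nonempty (BDMSS.{u}ᵒᵖ ≌ GPSS.{u}) :=
  ⟨⟨KAlgFrmS.compactsFunctor.asEquivalence⟩,
    ⟨KAlgFrmS.compactsFunctor.asEquivalence.op.trans BDMSS.specFunctor.asEquivalence⟩,
    ⟨BDMSS.specFunctor.asEquivalence⟩⟩
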